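/- Let $n\ge 1$ and let $\mathcal X_1,\dots,\mathcal X_n$ and $\mathcal Y_1,\dots,\mathcal Y_n$ be complex Euclidean spaces, that is, spaces $\mathbb C^{\Sigma}$ with $\Sigma$ finite and nonempty. Let $S_1(\mathcal X_1;\mathcal Y_1)$ be the set of positive semidefinite operators $X_1$ on $\mathcal Y_1\otimes\mathcal X_1$ with $\operatorname{Tr}_{\mathcal Y_1}(X_1)=\mathbb 1_{\mathcal X_1}$. For $2\le k\le n$ let $S_k(\mathcal X_1,\dots,\mathcal X_k;\mathcal Y_1,\dots,\mathcal Y_k)$ be the set of positive semidefinite operators $X_k$ on $\mathcal Y_1\otimes\cdots\otimes\mathcal Y_k\otimes\mathcal X_1\otimes\cdots\otimes\mathcal X_k$ such that $\operatorname{Tr}_{\mathcal Y_k}(X_k)=X_{k-1}\otimes\mathbb 1_{\mathcal X_k}$ for some $X_{k-1}\in S_{k-1}(\mathcal X_1,\dots,\mathcal X_{k-1};\mathcal Y_1,\dots,\mathcal Y_{k-1})$. Let $W$ be the isometry with $$W(y_1\otimes\cdots\otimes y_n\otimes x_1\otimes\cdots\otimes x_n)=x_n\otimes\cdots\otimes x_1\otimes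 y_n\otimes\cdots\otimes y_1 ,$$ and write $\langle A,B\rangle=\operatorname{Tr}(A^*B)$. Then for every vector $u\in\mathcal Y_1\otimes\cdots\otimes\mathcal Y_n\otimes\mathcal X_1\otimes\cdots\otimes\mathcal X_n$ both of the following maxima are attained and they are equal: $$\max\{\langle uu^*,X\rangle : X\in S_n(\mathcal X_1,\dots,\mathcal X_n;\mathcal Y_1,\dots,\mathcal Y_n)\}=\max\{\langle Wuu^*W^*,Y\rangle : Y\in S_n(\mathcal Y_n,\dots,\mathcal Y_1;\mathcal X_n,\dots,\mathcal X_1)\}.$$ In terms of network conditional min-entropies, also $$H_{\min}(\mathsf Y_n\mid \mathsf X_1,\mathsf Y_1,\dots,\mathsf X_{n-1},\mathsf Y_{n-1},\mathsf X_n)_{uu^*}=H_{\min}(\mathsf X_1\mid \mathsf Y_n,\mathsf X_n,\dots,\mathsf Y_2,\mathsf X_2,\mathsf Y_1)_{uu^*}.$$ Here, for a positive semidefinite operator $P$, $$H_{\min}(\mathsf Y_n\mid \mathsf X_1,\mathsf Y_1,\dots,\mathsf X_n)_P=-\inf_{G}D_{\max}(P\,\|\,G\otimes\mathbb 1_{\mathcal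 Y_n}),\qquad D_{\max}(P\,\|\,Q)=\log_2\min\{\lambda\ge 0: P\le\lambda Q\},$$ with values in $[-\infty,\infty]$, $\log_2 0=-\infty$ and $\min\emptyset=+\infty$. The infimum is over all positive semidefinite $G=G_n$ on $\mathcal Y_1\otimes\cdots\otimes\mathcal Y_{n-1}\otimes\mathcal X_1\otimes\cdots\otimes\mathcal X_n$ for which there are positive semidefinite $G_k$ on $\mathcal Y_1\otimes\cdots\otimes\mathcal Y_{k-1}\otimes\mathcal X_1\otimes\cdots\otimes\mathcal X_k$ $(1\le k<n)$ with $\operatorname{Tr}_{\mathcal X_k}(G_k)=G_{k-1}\otimes\mathbb 1_{\mathcal Y_{k-1}}$ for $2\le k\le n$ and $\operatorname{Tr}(G_1)=1$. The entropy on the right-hand side is the same quantity for the input spaces $\mathcal Y_n,\dots,\mathcal Y_1$, the output spaces $\mathcal X_n,\dots,\mathcal X_1$ and the operator $Wuu^*W^*$. -/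

import Mathlib

open scoped ComplexOrder ENNReal NNReal

universe uX uY

namespace QuantumStrategy

/-- The operator index set of `Y₁ ⊗ ⋯ ⊗ Yₙ ⊗ X₁ ⊗ ⋯ ⊗ Xₙ`. The complex Euclidean space of a register
with classical state set `X i` is `ℂ^(X i)`; the tensor product of such spaces is the space of
complex functions on the product of the state sets, and operators are square matrices. -/
abbrev Idx {n : ℕ} (X : Fin n → Type uX) (Y : Fin n → Type uY) : Type (max uX uY) :=
  (∀ i, Y i) × (∀ i, X i)

/-- The index set of `Y₁ ⊗ ⋯ ⊗ Yₙ ⊗ X₁ ⊗ ⋯ ⊗ Xₙ₊₁` (the last output space is missing). -/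
abbrev MidIdx {n : ℕ} (X : Fin (n + 1) → Type uX) (Y : Fin (n + 1) → Type uY) : Type (max uX uY) :=
  (∀ i : Fin n, Y i.castSucc) × (∀ i, X i)

/-- The index set of `Y₁ ⊗ ⋯ ⊗ Yₙ ⊗ X₁ ⊗ ⋯ ⊗ Xₙ` (both last spaces are missing). -/
abbrev InitIdx {n : ℕ} (X : Fin (n + 1) → Type uX) (Y : Fin (n + 1) → Type uY) : Type (max uX uY) :=
  Idx (fun i : Fin n => X i.castSucc) (fun i : Fin n => Y i.castSucc)

/-- The partial trace over the last output space. -/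
def traceLastOut {n : ℕ} {X : Fin (n + 1) → Type uX} {Y : Fin (n + 1) → Type uY}
    [∀ i, Fintype (Y i)] (M : Matrix (Idx X Y) (Idx X Y) ℂ) :
    Matrix (MidIdx X Y) (MidIdx X Y) ℂ :=
  Matrix.of fun p q => ∑ b : Y (Fin.last n),
    M (Fin.snoc (α := Y) p.1 b, p.2) (Fin.snoc (α := Y) q.1 b, q.2)

/-- `N ⊗ 1` with the identity on the last input space. -/
def tensorOneLastIn {n : ℕ} {X : Fin (n + 1) → Type uX} {Y : Fin (n + 1) → Type uY}
    [∀ i, DecidableEq (X i)] (N : Matrix (InitIdx X Y) (InitIdx X Y) ℂ) :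
    Matrix (MidIdx X Y) (MidIdx X Y) ℂ :=
  Matrix.of fun p q => N (p.1, Fin.init p.2) (q.1, Fin.init q.2) *
    (1 : Matrix (X (Fin.last n)) (X (Fin.last n)) ℂ) (p.2 (Fin.last n)) (q.2 (Fin.last n))

/-- The partial trace over the last input space. -/
def traceLastIn {n : ℕ} {X : Fin (n + 1) → Type uX} {Y : Fin (n + 1) → Type uY}
    [∀ i, Fintype (X i)] (G : Matrix (MidIdx X Y) (MidIdx X Y) ℂ) :
    Matrix (InitIdx X Y) (InitIdx X Y) ℂ :=
  Matrix.of fun p q => ∑ a : X (Fin.last n),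
    G (p.1, Fin.snoc (α := X) p.2 a) (q.1, Fin.snoc (α := X) q.2 a)

/-- `G ⊗ 1` with the identity on the last output space. -/
def tensorOneLastOut {n : ℕ} {X : Fin (n + 1) → Type uX} {Y : Fin (n + 1) → Type uY}
    [∀ i, DecidableEq (Y i)] (G : Matrix (MidIdx X Y) (MidIdx X Y) ℂ) :
    Matrix (Idx X Y) (Idx X Y) ℂ :=
  Matrix.of fun p q => G (Fin.init p.1, p.2) (Fin.init q.1, q.2) *
    (1 : Matrix (Y (Fin.last n)) (Y (Fin.last n)) ℂ) (p.1 (Fin.last n)) (q.1 (Fin.last n))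

/-- `M ∈ Sₙ(X₁, …, Xₙ; Y₁, …, Yₙ)`: `M` is positive semidefinite and
`Tr_{Yₙ} M = N ⊗ 1_{Xₙ}` for some `N ∈ Sₙ₋₁(X₁, …, Xₙ₋₁; Y₁, …, Yₙ₋₁)`. The recursion starts from
`S₀ = {1}` on the one-dimensional space, so that for `n = 1` the condition is `Tr_{Y₁} M = 1_{X₁}`. -/
def IsStrategyOperator : (n : ℕ) → (X : Fin n → Type uX) → (Y : Fin n → Type uY) →
    [∀ i, DecidableEq (X i)] → [∀ i, Fintype (Y i)] → Matrix (Idx X Y) (Idx X Y) ℂ → Prop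
  | 0, _, _, _, _, M => M = Matrix.of fun _ _ => 1
  | n + 1, X, Y, _, _, M => M.PosSemidef ∧ ∃ N : Matrix (InitIdx X Y) (InitIdx X Y) ℂ,
      IsStrategyOperator n (fun i => X i.castSucc) (fun i => Y i.castSucc) N ∧
        traceLastOut M = tensorOneLastIn N

/-- `Q = G ⊗ 1_{Yₙ}`, where `G` is the (positive semidefinite) operator on
`Y₁ ⊗ ⋯ ⊗ Yₙ₋₁ ⊗ X₁ ⊗ ⋯ ⊗ Xₙ` of a network that first emits `X₁`, then receives `Y₁` and emits `X₂`,
and so on up to receiving `Yₙ₋₁` and emitting `Xₙ`: there are positive semidefinite `G₁, …, Gₙ = G`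
with `Tr_{X_k} G_k = G_{k-1} ⊗ 1_{Y_{k-1}}` for `2 ≤ k ≤ n`, and `Tr G₁ = 1`. -/
def IsConditioningOperator : (n : ℕ) → (X : Fin n → Type uX) → (Y : Fin n → Type uY) →
    [∀ i, Fintype (X i)] → [∀ i, DecidableEq (Y i)] → Matrix (Idx X Y) (Idx X Y) ℂ → Prop
  | 0, _, _, _, _, Q => Q = Matrix.of fun _ _ => 1
  | n + 1, X, Y, _, _, Q => ∃ G : Matrix (MidIdx X Y) (MidIdx X Y) ℂ, G.PosSemidef ∧
      IsConditioningOperator n (fun i => X i.castSucc) (fun i => Y i.castSucc) (traceLastIn G) ∧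
        Q = tensorOneLastOut G

/-- The max-relative entropy `log₂ min {r ≥ 0 : P ≤ r Q}`, with value `⊤` if there is no such `r`,
and `⊥` if the minimum is `0`. -/
noncomputable def maxRelEntropy {ι : Type*} (P Q : Matrix ι ι ℂ) : EReal :=
  ENNReal.log (⨅ (r : ℝ≥0) (_ : (((r : ℝ) : ℂ) • Q - P).PosSemidef), (r : ℝ≥0∞)) /
    ((Real.log 2 : ℝ) : EReal)

/-- The network conditional min-entropy `H_min(Yₙ | X₁, Y₁, …, Xₙ₋₁, Yₙ₋₁, Xₙ)_P`, that is
`- inf_G D_max(P ‖ G ⊗ 1_{Yₙ})` over all `G` as in `IsConditioningOperator`. -/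
noncomputable def networkMinEntropy {n : ℕ} (X : Fin n → Type uX) (Y : Fin n → Type uY)
    [∀ i, Fintype (X i)] [∀ i, DecidableEq (Y i)] (P : Matrix (Idx X Y) (Idx X Y) ℂ) : EReal :=
  -⨅ (Q : Matrix (Idx X Y) (Idx X Y) ℂ) (_ : IsConditioningOperator n X Y Q), maxRelEntropy P Q

/-- The Hilbert-Schmidt inner product `⟨A, B⟩ = Tr (A* B)`. -/
noncomputable def hsInner {ι : Type*} [Fintype ι] (A B : Matrix ι ι ℂ) : ℂ :=
  (A.conjTranspose * B).trace

/-- `r` is the optimum value (attained maximum) of the problem of maximizing `⟨H, A⟩` over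
`A ∈ Sₙ(X₁, …, Xₙ; Y₁, …, Yₙ)`, for a Hermitian `H`, so that `⟨H, A⟩` is real. -/
def IsOptimumValue {n : ℕ} (X : Fin n → Type uX) (Y : Fin n → Type uY)
    [∀ i, Fintype (X i)] [∀ i, DecidableEq (X i)] [∀ i, Fintype (Y i)]
    (H : Matrix (Idx X Y) (Idx X Y) ℂ) (r : ℝ) : Prop :=
  IsGreatest {t : ℝ | ∃ A, IsStrategyOperator n X Y A ∧ t = (hsInner H A).re} r

/-- The operator `u u*`. -/
def rankOne {ι : Type*} (u : ι → ℂ) : Matrix ι ι ℂ :=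
  Matrix.vecMulVec u (star u)

/-- The isometry `W` that reverses the order of the tensor factors. It is given by its matrix: it
sends the standard basis vector `y₁ ⊗ ⋯ ⊗ yₙ ⊗ x₁ ⊗ ⋯ ⊗ xₙ` to
`xₙ ⊗ ⋯ ⊗ x₁ ⊗ yₙ ⊗ ⋯ ⊗ y₁`. -/
def reversal {n : ℕ} (X : Fin n → Type uX) (Y : Fin n → Type uY)
    [∀ i, DecidableEq (X i)] [∀ i, DecidableEq (Y i)] :
    Matrix (Idx (fun i : Fin n => Y i.rev) (fun i : Fin n => X i.rev)) (Idx X Y) ℂ :=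
  Matrix.of fun p q =>
    if p = ((fun i : Fin n => q.2 i.rev), (fun i : Fin n => q.1 i.rev)) then 1 else 0

end QuantumStrategy

/-!
Both equalities hold because the circuits behind the two optimization problems can be read
backwards.

A circuit is given by a memory `ℂ^Z`, an initial row vector `c` of norm at most one, and for every
`k` matrices `W k y x` that act on the memory when the registers `Yₖ`, `Xₖ` are in the states `y`,
`x`. Its operator `D` has the row `c W₁ ⋯ Wₙ` at a tuple of states (`circuitAmplitude`). For a
strategy, `W k` comes from a contraction that receives `Xₖ` and emits `Yₖ`; for a conditioning
operator, it emits `Xₖ` by a contraction and then receives `Yₖ` by another one. In both cases the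
transposed matrices `(W k y x)ᵀ` have the same form with the roles of `Xₖ` and `Yₖ` exchanged,
since the transpose of a contraction is a contraction.

The operators of both problems are described by circuits. Every strategy or conditioning operator
is `D D*` for some circuit, by Douglas' factorization lemma applied at each step of the recursion
(`IsStrategyOperator.exists_circuit`, `IsConditioningOperator.exists_circuit`). Conversely `D D*`
is always dominated by such an operator, because the defect in each partial trace condition can be
filled up (`exists_isStrategyOperator_of_circuit`, `exists_isConditioningOperator_of_circuit`).

Now let `b b* ≤ r D D*`. By Douglas' lemma `b = √r D w` with `‖w‖ ≤ 1`, that is, `b` has the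
entries `√r c W₁ ⋯ Wₙ w`. Such a number is equal to its transpose `√r wᵀ Wₙᵀ ⋯ W₁ᵀ cᵀ`, so the
reversal of `b` is `√r D' c` for the operator `D'` of the reversed circuit with initial vector `w`,
and its rank-one operator is dominated by `r D' D'*` (`IsStrategyOperator.exists_reversed`,
`IsConditioningOperator.exists_reversed`). For conditioning operators and `b = u` this says that
the reversed problem has at least the same min-entropy. For a strategy operator `A`, the vector
`b = A u / √⟨u, A u⟩` satisfies `b b* ≤ A` and `|⟨u, b⟩|² = ⟨u, A u⟩`, so the reversed problem has
at least the same value. Since reversal is an involution, equality holds in both cases. The maxima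
are attained because the set of strategy operators is compact.
-/

namespace QuantumStrategy

open Matrix

/-! ### Contractions and Douglas' lemma -/

section Contraction

variable {ι κ μ : Type*}

/-- The matrix `V` is a contraction from `ℂ^κ` to `ℂ^ι`, in the form `V V* ≤ 1`. -/
def IsContraction [Fintype κ] [DecidableEq ι] (V : Matrix ι κ ℂ) : Prop :=
  (1 - V * Vᴴ).PosSemidef

lemma isContraction_iff_conjTranspose_mul [Fintype ι] [Fintype κ] [DecidableEq ι] [DecidableEq κ]
    {V : Matrix ι κ ℂ} : IsContraction V ↔ (1 - Vᴴ * V).PosSemidef := by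
  -- Both conditions are Schur complements of the block matrix `[1, V; V*, 1]`.
  have := invertibleOne (α := Matrix ι ι ℂ)
  have := invertibleOne (α := Matrix κ κ ℂ)
  have h1 := Matrix.PosDef.fromBlocks₁₁ (A := (1 : Matrix ι ι ℂ)) V (1 : Matrix κ κ ℂ)
    Matrix.PosDef.one
  have h2 := Matrix.PosDef.fromBlocks₂₂ (1 : Matrix ι ι ℂ) V (D := (1 : Matrix κ κ ℂ))
    Matrix.PosDef.one
  simp only [inv_one, Matrix.mul_one] at h1 h2
  rw [IsContraction, ← h2, h1]

lemma isContraction_replicateCol [Fintype ι] [DecidableEq ι] {w : ι → ℂ} (h : star w ⬝ᵥ w ≤ 1) :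
    IsContraction (replicateCol Unit w) := by
  rw [isContraction_iff_conjTranspose_mul]
  convert (Matrix.PosSemidef.one (n := Unit) (R := ℂ)).smul (sub_nonneg.mpr h) using 1
  ext
  simp [Matrix.mul_apply, dotProduct]

lemma IsContraction.transpose [Fintype ι] [Fintype κ] [DecidableEq ι] [DecidableEq κ]
    {V : Matrix ι κ ℂ} (h : IsContraction V) : IsContraction Vᵀ := by
  rw [isContraction_iff_conjTranspose_mul] at h
  have := h.transpose
  rwa [transpose_sub, transpose_one, transpose_mul] at this

lemma isContraction_of_mul_conjTranspose_eq_one [Fintype κ] [DecidableEq ι] {V : Matrix ι κ ℂ}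
    (h : V * Vᴴ = 1) : IsContraction V := by
  rw [IsContraction, h, sub_self]
  exact .zero

lemma IsContraction.posSemidef_sub [Finite ι] [Fintype κ] [Fintype μ] [DecidableEq κ]
    {V : Matrix κ μ ℂ} (h : IsContraction V) (N : Matrix ι κ ℂ) :
    (N * Nᴴ - (N * V) * (N * V)ᴴ).PosSemidef := by
  have := h.mul_mul_conjTranspose_same N
  rwa [Matrix.mul_sub, Matrix.sub_mul, Matrix.mul_one, ← Matrix.mul_assoc N V,
    Matrix.mul_assoc (N * V), ← conjTranspose_mul] at this

/-- The square-root factorization of a positive semidefinite matrix, with the adjoint on the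
right. -/
lemma exists_eq_mul_conjTranspose [Fintype ι] {A : Matrix ι ι ℂ} (h : A.PosSemidef) :
    ∃ B : Matrix ι ι ℂ, A = B * Bᴴ := by
  classical
  open scoped MatrixOrder in
  obtain ⟨B, hB⟩ := CStarAlgebra.nonneg_iff_eq_star_mul_self.mp h.nonneg
  exact ⟨Bᴴ, by simpa [star_eq_conjTranspose] using hB⟩

lemma dotProduct_mul_conjTranspose_mulVec [Fintype ι] [Fintype κ] (M : Matrix ι κ ℂ) (v : ι → ℂ) :
    star v ⬝ᵥ ((M * Mᴴ) *ᵥ v) = ((‖WithLp.toLp 2 (Mᴴ *ᵥ v)‖ ^ 2 : ℝ) : ℂ) := by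
  rw [← mulVec_mulVec, dotProduct_mulVec, EuclideanSpace.norm_sq_eq]
  have : star v ᵥ* M = star (Mᴴ *ᵥ v) := by rw [star_mulVec, conjTranspose_conjTranspose]
  rw [this]
  simp only [dotProduct, Pi.star_apply, RCLike.star_def, Complex.conj_mul']
  push_cast
  rfl

/-- Douglas' factorization lemma: `M M* ≤ N N*` makes `M` the product of `N` and a contraction. -/
lemma exists_eq_mul_isContraction [Fintype ι] [Fintype κ] [Fintype μ] [DecidableEq κ]
    (M : Matrix ι μ ℂ) (N : Matrix ι κ ℂ) (h : (N * Nᴴ - M * Mᴴ).PosSemidef) :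
    ∃ V : Matrix κ μ ℂ, M = N * V ∧ IsContraction V := by
  classical
  let f : EuclideanSpace ℂ ι →ₗ[ℂ] EuclideanSpace ℂ κ := Matrix.toEuclideanLin Nᴴ
  let g : EuclideanSpace ℂ ι →ₗ[ℂ] EuclideanSpace ℂ μ := Matrix.toEuclideanLin Mᴴ
  have hfg : ∀ v, ‖g v‖ ≤ ‖f v‖ := fun v => by
    have := h.re_dotProduct_nonneg v.ofLp
    rw [sub_mulVec, dotProduct_sub, dotProduct_mul_conjTranspose_mulVec,
      dotProduct_mul_conjTranspose_mulVec] at this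
    simp only [map_sub, RCLike.re_to_complex, Complex.ofReal_re, sub_nonneg] at this
    exact (sq_le_sq₀ (norm_nonneg _) (norm_nonneg _)).mp this
  -- `V*` maps `N* v` to `M* v`, and is zero on the orthogonal complement of the range of `N*`.
  obtain ⟨s, hs⟩ := f.rangeRestrict.exists_rightInverse_of_surjective f.range_rangeRestrict
  have hs' : ∀ w, f (s w) = w := fun w => congrArg Subtype.val (LinearMap.congr_fun hs w)
  let k : EuclideanSpace ℂ κ →ₗ[ℂ] EuclideanSpace ℂ μ :=
    g ∘ₗ s ∘ₗ (LinearMap.range f).orthogonalProjectionOnto.toLinearMap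
  have hk : ∀ v, k (f v) = g v := fun v => by
    have h0 : f (s (f.rangeRestrict v) - v) = 0 := by rw [map_sub, hs']; simp
    have h1 := hfg (s (f.rangeRestrict v) - v)
    rw [h0, norm_zero, norm_le_zero_iff, map_sub, sub_eq_zero] at h1
    have h2 : (LinearMap.range f).orthogonalProjectionOnto (f v) = f.rangeRestrict v :=
      Submodule.orthogonalProjectionOnto_mem_subspace_eq_self (f.rangeRestrict v)
    simp [k, h2, h1]
  have hkn : ∀ w, ‖k w‖ ≤ ‖w‖ := fun w => by
    refine (hfg _).trans ?_
    rw [LinearMap.comp_apply, hs']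
    exact (LinearMap.range f).norm_orthogonalProjectionOnto_apply_le w
  let K : Matrix μ κ ℂ := Matrix.toEuclideanLin.symm k
  have hK : ∀ w, WithLp.toLp 2 (K *ᵥ w) = k (WithLp.toLp 2 w) := fun w => by
    have : Matrix.toEuclideanLin K = k := by simp [K]
    rw [← this]; rfl
  refine ⟨Kᴴ, ?_, ?_⟩
  · have : Mᴴ = K * Nᴴ := by
      apply Matrix.ext_of_mulVec_single
      intro i
      rw [← mulVec_mulVec]
      exact congrArg WithLp.ofLp (((hK _).trans (hk (WithLp.toLp 2 (Pi.single i 1)))).symm)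
    rw [← conjTranspose_conjTranspose M, this, conjTranspose_mul, conjTranspose_conjTranspose]
  · refine Matrix.PosSemidef.of_dotProduct_mulVec_nonneg
      (by simp [IsHermitian, conjTranspose_mul]) fun w => ?_
    rw [sub_mulVec, dotProduct_sub, dotProduct_mul_conjTranspose_mulVec,
      conjTranspose_conjTranspose, hK]
    have h1 := dotProduct_mul_conjTranspose_mulVec (1 : Matrix κ κ ℂ) w
    simp only [conjTranspose_one, Matrix.mul_one, one_mulVec] at h1
    rw [one_mulVec, h1, ← Complex.ofReal_sub, Complex.zero_le_real, sub_nonneg]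
    have := hkn (WithLp.toLp 2 w)
    gcongr

/-- The entries of a positive semidefinite matrix are bounded by its trace, by the nonnegativity of
its `2 × 2` minors. -/
lemma norm_apply_le_trace [Fintype κ] {A : Matrix κ κ ℂ} (h : A.PosSemidef) (p q : κ) :
    ‖A p q‖ ≤ A.trace.re := by
  have hd : ∀ i, 0 ≤ (A i i).re := fun i => (Complex.nonneg_iff.mp h.diag_nonneg).1
  have hi : ∀ i, A i i = ((A i i).re : ℂ) := fun i =>
    Complex.ext rfl (Complex.nonneg_iff.mp h.diag_nonneg).2.symm
  have ht : ∀ i, (A i i).re ≤ A.trace.re := fun i => by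
    rw [Matrix.trace, Complex.re_sum]
    exact Finset.single_le_sum (f := fun i => (A i i).re) (fun i _ => hd i) (Finset.mem_univ i)
  have hdet := (h.submatrix ![p, q]).det_nonneg
  have hqp : A q p = star (A p q) := (h.isHermitian.apply q p).symm
  rw [det_fin_two] at hdet
  simp only [submatrix_apply, cons_val_zero, cons_val_one] at hdet
  rw [hqp, hi p, hi q, RCLike.star_def, Complex.mul_conj', ← Complex.ofReal_mul] at hdet
  norm_cast at hdet
  have h1 := mul_le_mul (ht p) (ht q) (hd q) ((hd p).trans (ht p))
  refine abs_le_of_sq_le_sq' (by nlinarith) ((hd p).trans (ht p)) |>.2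

end Contraction

/-! ### Tensor factors and partial traces of the last registers -/

section LastRegister

variable {n : ℕ} {X : Fin (n + 1) → Type uX} {Y : Fin (n + 1) → Type uY} {Z : Type*}

/-- `C ⊗ 1` on the last input register, as a matrix with columns indexed by `Z × X`. -/
def ampliateLastIn [∀ i, DecidableEq (X i)] (C : Matrix (InitIdx X Y) Z ℂ) :
    Matrix (MidIdx X Y) (Z × X (Fin.last n)) ℂ :=
  .of fun m k => C (m.1, Fin.init m.2) k.1 *
    (1 : Matrix (X (Fin.last n)) (X (Fin.last n)) ℂ) (m.2 (Fin.last n)) k.2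

/-- `D ⊗ 1` on the last output register, as a matrix with columns indexed by `Z × Y`. -/
def ampliateLastOut [∀ i, DecidableEq (Y i)] (D : Matrix (MidIdx X Y) Z ℂ) :
    Matrix (Idx X Y) (Z × Y (Fin.last n)) ℂ :=
  .of fun p k => D (Fin.init p.1, p.2) k.1 *
    (1 : Matrix (Y (Fin.last n)) (Y (Fin.last n)) ℂ) (p.1 (Fin.last n)) k.2

/-- The matrix `D` with its last output register moved from the rows to the columns. -/
def flattenLastOut (D : Matrix (Idx X Y) Z ℂ) : Matrix (MidIdx X Y) (Z × Y (Fin.last n)) ℂ :=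
  .of fun m k => D (Fin.snoc (α := Y) m.1 k.2, m.2) k.1

/-- The matrix `D` with its last input register moved from the rows to the columns. -/
def flattenLastIn (D : Matrix (MidIdx X Y) Z ℂ) : Matrix (InitIdx X Y) (Z × X (Fin.last n)) ℂ :=
  .of fun m k => D (m.1, Fin.snoc (α := X) m.2 k.2) k.1

lemma flattenLastOut_apply (D : Matrix (Idx X Y) Z ℂ) (p : Idx X Y) (z : Z) :
    D p z = flattenLastOut D (Fin.init p.1, p.2) (z, p.1 (Fin.last n)) := by
  simp [flattenLastOut]

lemma flattenLastIn_apply (D : Matrix (MidIdx X Y) Z ℂ) (p : MidIdx X Y) (z : Z) :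
    D p z = flattenLastIn D (p.1, Fin.init p.2) (z, p.2 (Fin.last n)) := by
  simp [flattenLastIn]

lemma ampliateLastIn_mul_conjTranspose [∀ i, Fintype (X i)] [∀ i, DecidableEq (X i)] [Fintype Z]
    (C : Matrix (InitIdx X Y) Z ℂ) :
    ampliateLastIn C * (ampliateLastIn C)ᴴ = tensorOneLastIn (C * Cᴴ) := by
  ext p q
  simp [ampliateLastIn, tensorOneLastIn, Matrix.mul_apply, Fintype.sum_prod_type, Matrix.one_apply,
    apply_ite]
  by_cases h : p.2 (Fin.last n) = q.2 (Fin.last n) <;> simp [h]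

lemma ampliateLastOut_mul_conjTranspose [∀ i, Fintype (Y i)] [∀ i, DecidableEq (Y i)] [Fintype Z]
    (D : Matrix (MidIdx X Y) Z ℂ) :
    ampliateLastOut D * (ampliateLastOut D)ᴴ = tensorOneLastOut (D * Dᴴ) := by
  ext p q
  simp [ampliateLastOut, tensorOneLastOut, Matrix.mul_apply, Fintype.sum_prod_type,
    Matrix.one_apply, apply_ite]
  by_cases h : p.1 (Fin.last n) = q.1 (Fin.last n) <;> simp [h]

lemma flattenLastOut_mul_conjTranspose [∀ i, Fintype (Y i)] [Fintype Z]
    (D : Matrix (Idx X Y) Z ℂ) :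
    flattenLastOut D * (flattenLastOut D)ᴴ = traceLastOut (D * Dᴴ) := by
  ext p q
  simp [flattenLastOut, traceLastOut, Matrix.mul_apply, Fintype.sum_prod_type_right]

lemma flattenLastIn_mul_conjTranspose [∀ i, Fintype (X i)] [Fintype Z]
    (D : Matrix (MidIdx X Y) Z ℂ) :
    flattenLastIn D * (flattenLastIn D)ᴴ = traceLastIn (D * Dᴴ) := by
  ext p q
  simp [flattenLastIn, traceLastIn, Matrix.mul_apply, Fintype.sum_prod_type_right]

lemma tensorOneLastIn_sub [∀ i, DecidableEq (X i)] (M N : Matrix (InitIdx X Y) (InitIdx X Y) ℂ) :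
    tensorOneLastIn (M - N) = tensorOneLastIn M - tensorOneLastIn N := by
  ext p q
  simp [tensorOneLastIn, sub_mul]

lemma tensorOneLastOut_sub [∀ i, DecidableEq (Y i)] (M N : Matrix (MidIdx X Y) (MidIdx X Y) ℂ) :
    tensorOneLastOut (M - N) = tensorOneLastOut M - tensorOneLastOut N := by
  ext p q
  simp [tensorOneLastOut, sub_mul]

lemma traceLastOut_add [∀ i, Fintype (Y i)] (M N : Matrix (Idx X Y) (Idx X Y) ℂ) :
    traceLastOut (M + N) = traceLastOut M + traceLastOut N := by
  ext p q
  simp [traceLastOut, Finset.sum_add_distrib]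

lemma traceLastIn_add [∀ i, Fintype (X i)] (M N : Matrix (MidIdx X Y) (MidIdx X Y) ℂ) :
    traceLastIn (M + N) = traceLastIn M + traceLastIn N := by
  ext p q
  simp [traceLastIn, Finset.sum_add_distrib]

lemma traceLastOut_smul_tensorOneLastOut [∀ i, Fintype (Y i)] [∀ i, DecidableEq (Y i)]
    [∀ i, Nonempty (Y i)] (M : Matrix (MidIdx X Y) (MidIdx X Y) ℂ) :
    traceLastOut ((Fintype.card (Y (Fin.last n)) : ℂ)⁻¹ • tensorOneLastOut M) = M := by
  ext p q
  have h (b : Y (Fin.last n)) : (1 : Matrix (Y (Fin.last n)) (Y (Fin.last n)) ℂ)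
      (Fin.snoc (α := Y) p.1 b (Fin.last n)) (Fin.snoc (α := Y) q.1 b (Fin.last n)) = 1 := by
    exact (congrArg₂ (1 : Matrix (Y (Fin.last n)) (Y (Fin.last n)) ℂ)
      (Fin.snoc_last (α := Y) b p.1) (Fin.snoc_last (α := Y) b q.1)).trans (one_apply_eq b)
  simp [traceLastOut, tensorOneLastOut, h]

lemma traceLastIn_smul_tensorOneLastIn [∀ i, Fintype (X i)] [∀ i, DecidableEq (X i)]
    [∀ i, Nonempty (X i)] (M : Matrix (InitIdx X Y) (InitIdx X Y) ℂ) :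
    traceLastIn ((Fintype.card (X (Fin.last n)) : ℂ)⁻¹ • tensorOneLastIn M) = M := by
  ext p q
  have h (b : X (Fin.last n)) : (1 : Matrix (X (Fin.last n)) (X (Fin.last n)) ℂ)
      (Fin.snoc (α := X) p.2 b (Fin.last n)) (Fin.snoc (α := X) q.2 b (Fin.last n)) = 1 := by
    exact (congrArg₂ (1 : Matrix (X (Fin.last n)) (X (Fin.last n)) ℂ)
      (Fin.snoc_last (α := X) b p.2) (Fin.snoc_last (α := X) b q.2)).trans (one_apply_eq b)
  simp [traceLastIn, tensorOneLastIn, h]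

lemma posSemidef_tensorOneLastIn [∀ i, Fintype (X i)] [∀ i, DecidableEq (X i)]
    [∀ i, Fintype (Y i)] {M : Matrix (InitIdx X Y) (InitIdx X Y) ℂ} (h : M.PosSemidef) :
    (tensorOneLastIn M).PosSemidef := by
  obtain ⟨B, rfl⟩ := exists_eq_mul_conjTranspose h
  rw [← ampliateLastIn_mul_conjTranspose]
  exact posSemidef_self_mul_conjTranspose _

lemma posSemidef_tensorOneLastOut [∀ i, Fintype (X i)] [∀ i, Fintype (Y i)]
    [∀ i, DecidableEq (Y i)] {M : Matrix (MidIdx X Y) (MidIdx X Y) ℂ} (h : M.PosSemidef) :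
    (tensorOneLastOut M).PosSemidef := by
  obtain ⟨B, rfl⟩ := exists_eq_mul_conjTranspose h
  rw [← ampliateLastOut_mul_conjTranspose]
  exact posSemidef_self_mul_conjTranspose _

/-- A positive semidefinite operator whose partial trace is at most `T` is dominated by one whose
partial trace is equal to `T`. -/
lemma exists_traceLastOut_eq [∀ i, Fintype (X i)] [∀ i, Fintype (Y i)]
    [∀ i, DecidableEq (Y i)] [∀ i, Nonempty (Y i)] {M : Matrix (Idx X Y) (Idx X Y) ℂ}
    {T : Matrix (MidIdx X Y) (MidIdx X Y) ℂ} (hM : M.PosSemidef)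
    (h : (T - traceLastOut M).PosSemidef) :
    ∃ A : Matrix (Idx X Y) (Idx X Y) ℂ, A.PosSemidef ∧ traceLastOut A = T ∧
      (A - M).PosSemidef := by
  have hp := (posSemidef_tensorOneLastOut h).smul
    (show (0 : ℂ) ≤ (Fintype.card (Y (Fin.last n)) : ℂ)⁻¹ by positivity)
  refine ⟨M + (Fintype.card (Y (Fin.last n)) : ℂ)⁻¹ • tensorOneLastOut (T - traceLastOut M),
    hM.add hp, ?_, by rwa [add_sub_cancel_left]⟩
  rw [traceLastOut_add, traceLastOut_smul_tensorOneLastOut, add_sub_cancel]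

/-- The analogue of `exists_traceLastOut_eq` for the last input space. -/
lemma exists_traceLastIn_eq [∀ i, Fintype (X i)] [∀ i, Fintype (Y i)]
    [∀ i, DecidableEq (X i)] [∀ i, Nonempty (X i)] {M : Matrix (MidIdx X Y) (MidIdx X Y) ℂ}
    {T : Matrix (InitIdx X Y) (InitIdx X Y) ℂ} (hM : M.PosSemidef)
    (h : (T - traceLastIn M).PosSemidef) :
    ∃ A : Matrix (MidIdx X Y) (MidIdx X Y) ℂ, A.PosSemidef ∧ traceLastIn A = T ∧
      (A - M).PosSemidef := by
  have hp := (posSemidef_tensorOneLastIn h).smul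
    (show (0 : ℂ) ≤ (Fintype.card (X (Fin.last n)) : ℂ)⁻¹ by positivity)
  refine ⟨M + (Fintype.card (X (Fin.last n)) : ℂ)⁻¹ • tensorOneLastIn (T - traceLastIn M),
    hM.add hp, ?_, by rwa [add_sub_cancel_left]⟩
  rw [traceLastIn_add, traceLastIn_smul_tensorOneLastIn, add_sub_cancel]

end LastRegister

/-! ### Circuits and their reversal -/

section Circuit

variable {n : ℕ} {X : Fin n → Type uX} {Y : Fin n → Type uY} {Z : Type*} [Fintype Z]
  [DecidableEq Z]

/-- The ordered product `W₁ ⋯ Wₙ` of the matrices that the registers select. -/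
def transferProduct (W : ∀ k, Y k → X k → Matrix Z Z ℂ) (p : Idx X Y) : Matrix Z Z ℂ :=
  (List.ofFn fun k => W k (p.1 k) (p.2 k)).prod

/-- The operator `D` of a circuit with memory `ℂ^Z`: the row of `D` with index `p` is the final
memory vector `c W₁ ⋯ Wₙ` for the initial vector `c`. Vectors are rows and matrices act from the
right. -/
def circuitAmplitude (c : Z → ℂ) (W : ∀ k, Y k → X k → Matrix Z Z ℂ) : Matrix (Idx X Y) Z ℂ :=
  .of fun p => c ᵥ* transferProduct W p

/-- The step `W` of a circuit that receives a register `X` and emits a register `Y`: it comes from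
a contraction between `Z × X` and `Z × Y`. -/
def IsStrategyStep {X : Type uX} {Y : Type uY} [Fintype Y] [DecidableEq X]
    (W : Y → X → Matrix Z Z ℂ) : Prop :=
  IsContraction (Matrix.of fun (a : Z × X) (b : Z × Y) => W b.2 a.2 a.1 b.1)

/-- The step `W` of a circuit that emits a register `X` and then receives a register `Y`: it is
composed of a contraction `E` between `Z` and `K × X` and a contraction `R` between `K × Y`
and `Z`. -/
def IsConditioningStep.{v} {Z : Type v} [Fintype Z] [DecidableEq Z] {X : Type uX} {Y : Type uY}
    [Fintype X] [DecidableEq Y] (W : Y → X → Matrix Z Z ℂ) : Prop :=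
  ∃ (K : Type v) (_ : Fintype K) (_ : DecidableEq K) (E : Matrix Z (K × X) ℂ)
    (R : Matrix (K × Y) Z ℂ), IsContraction E ∧ IsContraction R ∧
      ∀ y x, W y x = (E.submatrix id fun k => (k, x)) * (R.submatrix (fun k => (k, y)) id)

lemma IsStrategyStep.transpose {X : Type uX} {Y : Type uY} [Fintype X] [Fintype Y]
    [DecidableEq X] [DecidableEq Y] {W : Y → X → Matrix Z Z ℂ} (h : IsStrategyStep W) :
    IsStrategyStep fun x y => (W y x)ᵀ :=
  IsContraction.transpose h

lemma IsConditioningStep.transpose.{v} {Z : Type v} [Fintype Z] [DecidableEq Z]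
    {X : Type uX} {Y : Type uY} [Fintype X] [Fintype Y]
    [DecidableEq X] [DecidableEq Y] {W : Y → X → Matrix Z Z ℂ} (h : IsConditioningStep W) :
    IsConditioningStep fun x y => (W y x)ᵀ := by
  obtain ⟨K, _, _, E, R, hE, hR, hW⟩ := h
  refine ⟨K, inferInstance, inferInstance, Rᵀ, Eᵀ, hR.transpose, hE.transpose, fun x y => ?_⟩
  change (W y x)ᵀ = _
  rw [hW, transpose_mul]
  rfl

lemma circuitAmplitude_apply (c : Z → ℂ) (W : ∀ k, Y k → X k → Matrix Z Z ℂ) (p : Idx X Y) :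
    circuitAmplitude c W p = c ᵥ* transferProduct W p := rfl

lemma circuitAmplitude_zero {X : Fin 0 → Type uX} {Y : Fin 0 → Type uY} (c : Z → ℂ)
    (W : ∀ k, Y k → X k → Matrix Z Z ℂ) (p : Idx X Y) : circuitAmplitude c W p = c := by
  simp [circuitAmplitude_apply, transferProduct]

lemma circuitAmplitude_succ {X : Fin (n + 1) → Type uX} {Y : Fin (n + 1) → Type uY} (c : Z → ℂ)
    (W : ∀ k, Y k → X k → Matrix Z Z ℂ) (p : Idx X Y) :
    circuitAmplitude c W p =
      circuitAmplitude (X := fun i : Fin n => X i.castSucc) (Y := fun i : Fin n => Y i.castSucc) c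
          (fun k => W k.castSucc) (Fin.init p.1, Fin.init p.2) ᵥ*
        W (Fin.last n) (p.1 (Fin.last n)) (p.2 (Fin.last n)) := by
  rw [circuitAmplitude_apply, circuitAmplitude_apply, transferProduct, List.ofFn_succ',
    List.concat_eq_append, List.prod_append, vecMul_vecMul, List.prod_singleton]
  rfl

/-- Transposition reverses the order of a product. -/
lemma transferProduct_rev (W : ∀ k, Y k → X k → Matrix Z Z ℂ) (p : Idx X Y) :
    transferProduct (X := fun i : Fin n => Y i.rev) (Y := fun i : Fin n => X i.rev)
      (fun k x y => (W k.rev y x)ᵀ) (fun i => p.2 i.rev, fun i => p.1 i.rev) =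
      (transferProduct W p)ᵀ := by
  rw [transferProduct, transferProduct, transpose_list_prod]
  congr 1
  apply List.ext_getElem
  · simp
  · intro i h1 h2
    simp only [List.getElem_ofFn, List.getElem_reverse, List.getElem_map, List.length_map,
      List.length_ofFn]
    simp only [List.length_ofFn] at h1
    have : (⟨i, h1⟩ : Fin n).rev = ⟨n - 1 - i, by omega⟩ := by
      ext; simp [Fin.rev]; omega
    rw [this]

/-- Reading a circuit backwards exchanges its initial vector with the functional that is applied
to its final vector. -/
lemma circuitAmplitude_rev (c w : Z → ℂ) (W : ∀ k, Y k → X k → Matrix Z Z ℂ) (p : Idx X Y) :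
    circuitAmplitude (X := fun i : Fin n => Y i.rev) (Y := fun i : Fin n => X i.rev) w
      (fun k x y => (W k.rev y x)ᵀ) (fun i => p.2 i.rev, fun i => p.1 i.rev) ⬝ᵥ c =
      circuitAmplitude c W p ⬝ᵥ w := by
  rw [circuitAmplitude_apply, circuitAmplitude_apply, transferProduct_rev, vecMul_transpose,
    ← dotProduct_mulVec, dotProduct_comm]

end Circuit

/-! ### Strategy and conditioning operators as circuits -/

section Operators

/-- The isometry that embeds `ℂ^ι` into `ℂ^κ` along an injection, acting on row vectors. -/
def embeddingMatrix {ι κ : Type*} [DecidableEq κ] (f : ι ↪ κ) : Matrix ι κ ℂ :=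
  .of fun i j => if f i = j then 1 else 0

lemma embeddingMatrix_mul_conjTranspose {ι κ : Type*} [DecidableEq ι] [DecidableEq κ] [Fintype κ]
    (f : ι ↪ κ) : embeddingMatrix f * (embeddingMatrix f)ᴴ = 1 := by
  ext i j
  simp [embeddingMatrix, Matrix.mul_apply, Matrix.one_apply, apply_ite, eq_comm]

/-- Memory that has room for the states of all registers has room for those of the first `n`
pairs. -/
lemma nonempty_initIdx_embedding {n : ℕ} (X : Fin (n + 1) → Type uX) (Y : Fin (n + 1) → Type uY)
    [∀ i, Nonempty (X i)] [∀ i, Nonempty (Y i)] : Nonempty (InitIdx X Y ↪ Idx X Y) :=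
  ⟨⟨fun p => (Fin.snoc (α := Y) p.1 (Classical.arbitrary _),
      Fin.snoc (α := X) p.2 (Classical.arbitrary _)), fun p q h => by
    have h1 := congrArg (Fin.init (α := Y)) (congrArg Prod.fst h)
    have h2 := congrArg (Fin.init (α := X)) (congrArg Prod.snd h)
    rw [Fin.init_snoc, Fin.init_snoc] at h1 h2
    exact Prod.ext h1 h2⟩⟩

lemma circuitAmplitude_zero_mul_conjTranspose {X : Fin 0 → Type uX} {Y : Fin 0 → Type uY}
    {Z : Type*} [Fintype Z] [DecidableEq Z] (c : Z → ℂ) (W : ∀ k, Y k → X k → Matrix Z Z ℂ) :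
    circuitAmplitude c W * (circuitAmplitude c W)ᴴ =
      Matrix.of fun _ _ => ((replicateCol Unit c)ᴴ * replicateCol Unit c) () () := by
  ext p q
  simp only [Matrix.mul_apply, conjTranspose_apply, circuitAmplitude_zero, of_apply,
    replicateCol_apply]
  exact Finset.sum_congr rfl fun _ _ => mul_comm _ _

lemma posSemidef_one_sub_circuitAmplitude_zero {X : Fin 0 → Type uX} {Y : Fin 0 → Type uY}
    {Z : Type*} [Fintype Z] [DecidableEq Z] {c : Z → ℂ} (hc : IsContraction (replicateCol Unit c))
    (W : ∀ k, Y k → X k → Matrix Z Z ℂ) :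
    ((Matrix.of fun _ _ => 1) -
      circuitAmplitude c W * (circuitAmplitude c W)ᴴ).PosSemidef := by
  rw [circuitAmplitude_zero_mul_conjTranspose]
  rw [isContraction_iff_conjTranspose_mul] at hc
  exact hc.submatrix fun _ => ()

lemma circuitAmplitude_single_zero {X : Fin 0 → Type uX} {Y : Fin 0 → Type uY}
    {Z : Type*} [Fintype Z] [DecidableEq Z] (z : Z) (W : ∀ k, Y k → X k → Matrix Z Z ℂ) :
    (Matrix.of fun _ _ => 1) = circuitAmplitude (Pi.single z 1) W *
      (circuitAmplitude (Pi.single z 1) W)ᴴ := by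
  rw [circuitAmplitude_zero_mul_conjTranspose]
  ext
  simp [Matrix.mul_apply, Pi.single_apply, apply_ite]

/-- The last step of a strategy circuit, as a factorization of operators. -/
lemma flattenLastOut_circuitAmplitude {n : ℕ} {X : Fin (n + 1) → Type uX}
    {Y : Fin (n + 1) → Type uY} {Z : Type*} [Fintype Z] [DecidableEq Z] [∀ i, Fintype (X i)]
    [∀ i, DecidableEq (X i)] (c : Z → ℂ) (W : ∀ k, Y k → X k → Matrix Z Z ℂ) :
    flattenLastOut (circuitAmplitude c W) =
      ampliateLastIn (X := X) (Y := Y) (circuitAmplitude c fun k => W k.castSucc) *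
        Matrix.of fun (a : Z × X (Fin.last n)) (b : Z × Y (Fin.last n)) =>
          W (Fin.last n) b.2 a.2 a.1 b.1 := by
  ext m k
  simp only [flattenLastOut, of_apply, circuitAmplitude_succ, Fin.init_snoc, Fin.snoc_last]
  simp [ampliateLastIn, Matrix.mul_apply, Matrix.one_apply, vecMul, dotProduct,
    Fintype.sum_prod_type]

/-- The last step of a conditioning circuit, as a factorization of operators. -/
lemma circuitAmplitude_eq_ampliateLastOut_mul {n : ℕ} {X : Fin (n + 1) → Type uX}
    {Y : Fin (n + 1) → Type uY} {Z K : Type*} [Fintype Z] [DecidableEq Z] [Fintype K]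
    [∀ i, Fintype (Y i)] [∀ i, DecidableEq (Y i)] {c : Z → ℂ}
    {W : ∀ k, Y k → X k → Matrix Z Z ℂ} {E : Matrix Z (K × X (Fin.last n)) ℂ}
    {R : Matrix (K × Y (Fin.last n)) Z ℂ} (hW : ∀ y x, W (Fin.last n) y x =
      (E.submatrix id fun k => (k, x)) * (R.submatrix (fun k => (k, y)) id))
    {D : Matrix (MidIdx X Y) K ℂ} (hD : flattenLastIn D =
      circuitAmplitude (X := fun i : Fin n => X i.castSucc) (Y := fun i : Fin n => Y i.castSucc) c
        (fun k => W k.castSucc) * E) :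
    circuitAmplitude c W = ampliateLastOut D * R := by
  ext p z
  rw [circuitAmplitude_succ, hW, ← vecMul_vecMul]
  have h (k : K) : (circuitAmplitude (X := fun i : Fin n => X i.castSucc)
      (Y := fun i : Fin n => Y i.castSucc) c (fun k => W k.castSucc)
        (Fin.init p.1, Fin.init p.2) ᵥ* E.submatrix id fun k => (k, p.2 (Fin.last n))) k =
      D (Fin.init p.1, p.2) k := by
    rw [flattenLastIn_apply D, hD]
    rfl
  simp [vecMul, dotProduct, Matrix.mul_apply, ampliateLastOut, Fintype.sum_prod_type,
    Matrix.one_apply]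
  exact Finset.sum_congr rfl fun k _ => by rw [← h]; rfl

/-- Every strategy operator is `D D*` for the operator `D` of a circuit. -/
theorem IsStrategyOperator.exists_circuit : ∀ (n : ℕ) (X : Fin n → Type uX) (Y : Fin n → Type uY)
    [∀ i, Fintype (X i)] [∀ i, DecidableEq (X i)] [∀ i, Nonempty (X i)]
    [∀ i, Fintype (Y i)] [∀ i, Nonempty (Y i)] (A : Matrix (Idx X Y) (Idx X Y) ℂ),
    IsStrategyOperator n X Y A → ∀ {Z : Type*} [Fintype Z] [DecidableEq Z] (_ : Idx X Y ↪ Z),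
    ∃ (c : Z → ℂ) (W : ∀ k, Y k → X k → Matrix Z Z ℂ), IsContraction (replicateCol Unit c) ∧
      (∀ k, IsStrategyStep (W k)) ∧ A = circuitAmplitude c W * (circuitAmplitude c W)ᴴ
  | 0, X, Y, _, _, _, _, _, A, hA, Z, _, _, f => by
    refine ⟨Pi.single (f (fun i => i.elim0, fun i => i.elim0)) 1, fun k => k.elim0,
      isContraction_replicateCol (by simp [dotProduct_single]), fun k => k.elim0, ?_⟩
    rw [hA]
    exact circuitAmplitude_single_zero _ _
  | n + 1, X, Y, _, _, _, _, _, A, hA, Z, _, _, f => by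
    classical
    obtain ⟨hpos, N, hN, hAN⟩ := hA
    obtain ⟨g⟩ := nonempty_initIdx_embedding X Y
    obtain ⟨c, W, hc, hW, rfl⟩ := exists_circuit n (fun i => X i.castSucc)
      (fun i => Y i.castSucc) N hN (g.trans f)
    obtain ⟨B, hB⟩ := exists_eq_mul_conjTranspose hpos
    have hD : A = (B * embeddingMatrix f) * (B * embeddingMatrix f)ᴴ := by
      rw [conjTranspose_mul, Matrix.mul_assoc, ← Matrix.mul_assoc (embeddingMatrix f),
        embeddingMatrix_mul_conjTranspose, Matrix.one_mul, hB]
    set D := B * embeddingMatrix f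
    -- Both sides of the recursion condition are Gram matrices, so their factors differ by `V`.
    rw [hD, ← flattenLastOut_mul_conjTranspose, ← ampliateLastIn_mul_conjTranspose] at hAN
    obtain ⟨V, hV, hVc⟩ := exists_eq_mul_isContraction (flattenLastOut D)
      (ampliateLastIn (X := X) (Y := Y) (circuitAmplitude c W))
      (by rw [hAN, sub_self]; exact .zero)
    let W' : ∀ k, Y k → X k → Matrix Z Z ℂ :=
      Fin.snoc (α := fun k => Y k → X k → Matrix Z Z ℂ) W
        fun y x => .of fun z z' => V (z, x) (z', y)
    have hcs : (fun k : Fin n => W' k.castSucc) = W := funext fun k => Fin.snoc_castSucc ..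
    have hl : W' (Fin.last n) = fun y x => .of fun z z' => V (z, x) (z', y) := Fin.snoc_last ..
    refine ⟨c, W', hc, fun k => ?_, ?_⟩
    · induction k using Fin.lastCases with
      | last => rw [hl]; exact hVc
      | cast k => rw [show W' k.castSucc = W k from congrFun hcs k]; exact hW k
    · have : D = circuitAmplitude c W' := by
        ext p z
        rw [flattenLastOut_apply D, flattenLastOut_apply (circuitAmplitude c W'), hV,
          flattenLastOut_circuitAmplitude, hcs, hl]
        rfl
      rw [hD, this]

/-- For the operator `D` of a circuit, `D D*` is dominated by a strategy operator. -/
theorem exists_isStrategyOperator_of_circuit : ∀ (n : ℕ) (X : Fin n → Type uX)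
    (Y : Fin n → Type uY) [∀ i, Fintype (X i)] [∀ i, DecidableEq (X i)]
    [∀ i, Fintype (Y i)] [∀ i, Nonempty (Y i)] {Z : Type*} [Fintype Z] [DecidableEq Z]
    (c : Z → ℂ) (W : ∀ k, Y k → X k → Matrix Z Z ℂ), IsContraction (replicateCol Unit c) →
    (∀ k, IsStrategyStep (W k)) → ∃ A, IsStrategyOperator n X Y A ∧
      (A - circuitAmplitude c W * (circuitAmplitude c W)ᴴ).PosSemidef
  | 0, X, Y, _, _, _, _, Z, _, _, c, W, hc, _ =>
    ⟨_, rfl, posSemidef_one_sub_circuitAmplitude_zero hc W⟩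
  | n + 1, X, Y, _, _, _, _, Z, _, _, c, W, hc, hW => by
    classical
    obtain ⟨N, hN, hNC⟩ := exists_isStrategyOperator_of_circuit n (fun i => X i.castSucc)
      (fun i => Y i.castSucc) c (fun k => W k.castSucc) hc fun k => hW k.castSucc
    have h1 := (hW (Fin.last n)).posSemidef_sub
      (ampliateLastIn (X := X) (Y := Y) (circuitAmplitude c fun k => W k.castSucc))
    rw [← flattenLastOut_circuitAmplitude, flattenLastOut_mul_conjTranspose,
      ampliateLastIn_mul_conjTranspose] at h1
    have h2 := (posSemidef_tensorOneLastIn (X := X) (Y := Y) hNC).add h1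
    rw [tensorOneLastIn_sub, sub_add_sub_cancel] at h2
    obtain ⟨A, hA, hT, hAD⟩ := exists_traceLastOut_eq (posSemidef_self_mul_conjTranspose _) h2
    exact ⟨A, ⟨hA, N, hN, hT⟩, hAD⟩

/-- Every conditioning operator is `D D*` for the operator `D` of a circuit. -/
theorem IsConditioningOperator.exists_circuit : ∀ (n : ℕ) (X : Fin n → Type uX)
    (Y : Fin n → Type uY) [∀ i, Fintype (X i)] [∀ i, Nonempty (X i)]
    [∀ i, Fintype (Y i)] [∀ i, DecidableEq (Y i)] [∀ i, Nonempty (Y i)]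
    (Q : Matrix (Idx X Y) (Idx X Y) ℂ), IsConditioningOperator n X Y Q →
    ∀ {Z : Type (max uX uY)} [Fintype Z] [DecidableEq Z] (_ : Idx X Y ↪ Z),
    ∃ (c : Z → ℂ) (W : ∀ k, Y k → X k → Matrix Z Z ℂ), IsContraction (replicateCol Unit c) ∧
      (∀ k, IsConditioningStep (W k)) ∧ Q = circuitAmplitude c W * (circuitAmplitude c W)ᴴ
  | 0, X, Y, _, _, _, _, _, Q, hQ, Z, _, _, f => by
    refine ⟨Pi.single (f (fun i => i.elim0, fun i => i.elim0)) 1, fun k => k.elim0,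
      isContraction_replicateCol (by simp [dotProduct_single]), fun k => k.elim0, ?_⟩
    rw [hQ]
    exact circuitAmplitude_single_zero _ _
  | n + 1, X, Y, _, _, _, _, _, Q, hQ, Z, _, _, f => by
    classical
    obtain ⟨G, hpos, hG, hQG⟩ := hQ
    obtain ⟨g⟩ := nonempty_initIdx_embedding X Y
    obtain ⟨c, W, hc, hW, hGC⟩ := exists_circuit n (fun i => X i.castSucc)
      (fun i => Y i.castSucc) _ hG (g.trans f)
    obtain ⟨D, rfl⟩ := exists_eq_mul_conjTranspose hpos
    rw [← flattenLastIn_mul_conjTranspose] at hGC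
    obtain ⟨E, hE, hEc⟩ := exists_eq_mul_isContraction (flattenLastIn D) (circuitAmplitude c W)
      (by rw [hGC, sub_self]; exact .zero)
    -- The memory keeps the received register, so that no information about it is lost.
    let e : MidIdx X Y × Y (Fin.last n) ↪ Idx X Y :=
      ⟨fun m => (Fin.snoc (α := Y) m.1.1 m.2, m.1.2), fun m m' h => by
        have h1 := congrArg (Fin.init (α := Y)) (congrArg Prod.fst h)
        have h2 := congrFun (congrArg Prod.fst h) (Fin.last n)
        simp only [Fin.init_snoc, Fin.snoc_last] at h1 h2
        exact Prod.ext (Prod.ext h1 (congrArg Prod.snd h :)) h2⟩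
    let R := embeddingMatrix (e.trans f)
    have hR : R * Rᴴ = 1 := embeddingMatrix_mul_conjTranspose _
    let Wl : Y (Fin.last n) → X (Fin.last n) → Matrix Z Z ℂ := fun y x =>
      (E.submatrix id fun k => (k, x)) * (R.submatrix (fun k => (k, y)) id)
    let W' : ∀ k, Y k → X k → Matrix Z Z ℂ :=
      Fin.snoc (α := fun k => Y k → X k → Matrix Z Z ℂ) W Wl
    have hcs : (fun k : Fin n => W' k.castSucc) = W := funext fun k => Fin.snoc_castSucc ..
    have hl : W' (Fin.last n) = Wl := Fin.snoc_last ..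
    refine ⟨c, W', hc, fun k => ?_, ?_⟩
    · induction k using Fin.lastCases with
      | last =>
        rw [hl]
        exact ⟨_, inferInstance, inferInstance, E, R, hEc,
          isContraction_of_mul_conjTranspose_eq_one hR, fun _ _ => rfl⟩
      | cast k => rw [show W' k.castSucc = W k from congrFun hcs k]; exact hW k
    · rw [circuitAmplitude_eq_ampliateLastOut_mul (W := W') (E := E) (R := R) (D := D) (c := c)
        (fun _ _ => by rw [hl]) (by rw [hcs, hE]), conjTranspose_mul, Matrix.mul_assoc,
        ← Matrix.mul_assoc R, hR, Matrix.one_mul, ampliateLastOut_mul_conjTranspose, hQG]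

/-- For the operator `D` of a circuit, `D D*` is dominated by a conditioning operator. -/
theorem exists_isConditioningOperator_of_circuit.{v} : ∀ (n : ℕ) (X : Fin n → Type uX)
    (Y : Fin n → Type uY) [∀ i, Fintype (X i)] [∀ i, Nonempty (X i)]
    [∀ i, Fintype (Y i)] [∀ i, DecidableEq (Y i)] {Z : Type v} [Fintype Z] [DecidableEq Z]
    (c : Z → ℂ) (W : ∀ k, Y k → X k → Matrix Z Z ℂ), IsContraction (replicateCol Unit c) →
    (∀ k, IsConditioningStep (W k)) → ∃ Q, IsConditioningOperator n X Y Q ∧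
      (Q - circuitAmplitude c W * (circuitAmplitude c W)ᴴ).PosSemidef
  | 0, X, Y, _, _, _, _, Z, _, _, c, W, hc, _ =>
    ⟨_, rfl, posSemidef_one_sub_circuitAmplitude_zero hc W⟩
  | n + 1, X, Y, _, _, _, _, Z, _, _, c, W, hc, hW => by
    classical
    obtain ⟨Q', hQ', hQC⟩ := exists_isConditioningOperator_of_circuit n (fun i => X i.castSucc)
      (fun i => Y i.castSucc) c (fun k => W k.castSucc) hc fun k => hW k.castSucc
    obtain ⟨K, _, _, E, R, hE, hR, hWl⟩ := hW (Fin.last n)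
    let C := circuitAmplitude (X := fun i : Fin n => X i.castSucc)
      (Y := fun i : Fin n => Y i.castSucc) c fun k => W k.castSucc
    let D : Matrix (MidIdx X Y) K ℂ := .of fun m k =>
      (C * E) (m.1, Fin.init m.2) (k, m.2 (Fin.last n))
    have hD : flattenLastIn D = C * E := by
      ext m k
      simp [flattenLastIn, D]
    have h1 := hQC.add (hE.posSemidef_sub C)
    rw [sub_add_sub_cancel, ← hD, flattenLastIn_mul_conjTranspose] at h1
    obtain ⟨G, hG, hT, hGD⟩ := exists_traceLastIn_eq (posSemidef_self_mul_conjTranspose _) h1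
    refine ⟨tensorOneLastOut G, ⟨G, hG, by rwa [hT], rfl⟩, ?_⟩
    have h2 := (posSemidef_tensorOneLastOut hGD).add (hR.posSemidef_sub (ampliateLastOut D))
    rwa [ampliateLastOut_mul_conjTranspose, tensorOneLastOut_sub, sub_add_sub_cancel,
      ← circuitAmplitude_eq_ampliateLastOut_mul hWl hD] at h2

end Operators

/-! ### Compactness of the set of strategy operators -/

section Compactness

lemma isClosed_setOf_posSemidef {ι : Type*} [Fintype ι] :
    IsClosed {A : Matrix ι ι ℂ | A.PosSemidef} := by
  simp only [posSemidef_iff_dotProduct_mulVec, IsHermitian, Set.ofPred_and, Set.ofPred_forall]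
  refine (isClosed_eq (by fun_prop) continuous_id).inter (isClosed_iInter fun x => ?_)
  exact isClosed_le continuous_const (by fun_prop)

/-- The set of strategy operators is compact: it is closed, and the trace of its members, which
bounds their entries, is determined by the recursion. -/
theorem isCompact_setOf_isStrategyOperator : ∀ (n : ℕ) (X : Fin n → Type uX) (Y : Fin n → Type uY)
    [∀ i, Fintype (X i)] [∀ i, DecidableEq (X i)] [∀ i, Fintype (Y i)],
    IsCompact {A | IsStrategyOperator n X Y A}
  | 0, X, Y, _, _, _ => by
    simp only [IsStrategyOperator, Set.ofPred_eq_eq_singleton]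
    exact isCompact_singleton
  | n + 1, X, Y, _, _, _ => by
    classical
    have ih := isCompact_setOf_isStrategyOperator n (fun i => X i.castSucc) fun i => Y i.castSucc
    have hS : IsCompact ((tensorOneLastIn (X := X) (Y := Y)) ''
        {N | IsStrategyOperator n (fun i => X i.castSucc) (fun i => Y i.castSucc) N}) :=
      ih.image (continuous_matrix fun p q => by
        simp only [tensorOneLastIn, of_apply]
        fun_prop)
    have hT : Continuous (traceLastOut (X := X) (Y := Y)) := continuous_matrix fun p q => by
      simp only [traceLastOut, of_apply]
      fun_prop
    obtain ⟨R, hR⟩ := (hS.image (f := fun M => M.trace.re) (by fun_prop)).bddAbove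
    have htr (A : Matrix (Idx X Y) (Idx X Y) ℂ) : (traceLastOut A).trace = A.trace := by
      simp only [Matrix.trace, diag_apply, traceLastOut, of_apply]
      rw [← Fintype.sum_prod_type']
      refine Fintype.sum_equiv
        { toFun := fun m => (Fin.snoc (α := Y) m.1.1 m.2, m.1.2)
          invFun := fun p => ((Fin.init p.1, p.2), p.1 (Fin.last n))
          left_inv := fun m => by simp
          right_inv := fun p => by simp } _ _ fun m => rfl
    have hbox : IsCompact {A : Matrix (Idx X Y) (Idx X Y) ℂ |
        ∀ p, A p ∈ {a : Idx X Y → ℂ | ∀ q, a q ∈ Metric.closedBall (0 : ℂ) R}} :=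
      isCompact_pi_infinite fun _ => isCompact_pi_infinite fun _ => isCompact_closedBall _ _
    refine hbox.of_isClosed_subset (t := {A | IsStrategyOperator (n + 1) X Y A}) ?_ ?_
    · have : {A | IsStrategyOperator (n + 1) X Y A} = {A | A.PosSemidef} ∩ traceLastOut ⁻¹'
          (tensorOneLastIn '' {N | IsStrategyOperator n (fun i => X i.castSucc)
            (fun i => Y i.castSucc) N}) := by
        ext A
        simp only [IsStrategyOperator, Set.mem_ofPred_eq, Set.mem_inter_iff, Set.mem_preimage,
          Set.mem_image, eq_comm (a := traceLastOut A)]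
      rw [this]
      exact isClosed_setOf_posSemidef.inter (hS.isClosed.preimage hT)
    · rintro A ⟨hA, N, hN, hAN⟩ p q
      rw [mem_closedBall_zero_iff]
      refine (norm_apply_le_trace hA p q).trans (hR ⟨_, ⟨N, hN, rfl⟩, ?_⟩)
      simp only [← hAN, htr]

end Compactness

/-! ### Reversal of strategy and conditioning operators -/

section Reversal

lemma rankOne_eq_replicateCol_mul {ι : Type*} (b : ι → ℂ) :
    rankOne b = replicateCol Unit b * (replicateCol Unit b)ᴴ := by
  rw [rankOne, vecMulVec_eq Unit, conjTranspose_replicateCol]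

lemma dotProduct_rankOne_mulVec {ι : Type*} [Fintype ι] (u b : ι → ℂ) :
    star u ⬝ᵥ (rankOne b *ᵥ u) = ((‖star u ⬝ᵥ b‖ ^ 2 : ℝ) : ℂ) := by
  rw [rankOne, vecMulVec_mulVec, dotProduct_smul, op_smul_eq_mul,
    show star b ⬝ᵥ u = star (star u ⬝ᵥ b) by rw [star_dotProduct],
    RCLike.star_def, Complex.mul_conj']
  push_cast
  rfl

lemma hsInner_rankOne {ι : Type*} [Fintype ι] (u : ι → ℂ) (A : Matrix ι ι ℂ) :
    hsInner (rankOne u) A = star u ⬝ᵥ (A *ᵥ u) := by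
  rw [hsInner, rankOne, conjTranspose_vecMulVec, star_star, vecMulVec_mul, trace_vecMulVec,
    dotProduct_comm, dotProduct_mulVec]

/-- `r D D*` dominates `b b*` exactly if `b` is `√r D w` for a vector `w` of norm at most one. -/
lemma posSemidef_smul_sub_rankOne_iff {ι κ : Type*} [Fintype ι] [Fintype κ] [DecidableEq κ]
    (r : ℝ≥0) (D : Matrix ι κ ℂ) (b : ι → ℂ) :
    (((r : ℝ) : ℂ) • (D * Dᴴ) - rankOne b).PosSemidef ↔
      ∃ w : κ → ℂ, IsContraction (replicateCol Unit w) ∧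
        b = ((√(r : ℝ) : ℝ) : ℂ) • (D *ᵥ w) := by
  have hr : ((r : ℝ) : ℂ) • (D * Dᴴ) =
      (((√(r : ℝ) : ℝ) : ℂ) • D) * (((√(r : ℝ) : ℝ) : ℂ) • D)ᴴ := by
    rw [conjTranspose_smul, Matrix.smul_mul, Matrix.mul_smul, smul_smul, RCLike.star_def,
      Complex.conj_ofReal, ← Complex.ofReal_mul, Real.mul_self_sqrt r.coe_nonneg]
  rw [hr, rankOne_eq_replicateCol_mul]
  constructor
  · intro h
    obtain ⟨V, hV, hc⟩ := exists_eq_mul_isContraction _ _ h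
    refine ⟨fun z => V z (), hc, ?_⟩
    ext p
    simpa [Matrix.mul_apply, mulVec, dotProduct, Finset.mul_sum, mul_assoc] using
      congrFun₂ hV p ()
  · rintro ⟨w, hw, rfl⟩
    have := hw.posSemidef_sub (((√(r : ℝ) : ℝ) : ℂ) • D)
    rwa [← replicateCol_mulVec, smul_mulVec] at this

/-- A positive semidefinite `A` dominates a rank-one operator `b b*` with the same expectation at
the vector `u`. -/
lemma exists_rankOne_le {ι : Type*} [Fintype ι] {A : Matrix ι ι ℂ} (hA : A.PosSemidef)
    (u : ι → ℂ) : ∃ b : ι → ℂ, (A - rankOne b).PosSemidef ∧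
      star u ⬝ᵥ (A *ᵥ u) = star u ⬝ᵥ (rankOne b *ᵥ u) := by
  classical
  obtain ⟨B, rfl⟩ := exists_eq_mul_conjTranspose hA
  -- `b = B w` for the unit vector `w` along `v = B* u`; if `v = 0`, then `w = 0`.
  set v := Bᴴ *ᵥ u with hv
  set s : ℝ := ‖WithLp.toLp 2 v‖ with hs
  have hvv : star v ⬝ᵥ v = ((s ^ 2 : ℝ) : ℂ) := by
    have := dotProduct_mul_conjTranspose_mulVec (1 : Matrix ι ι ℂ) v
    simpa using this
  have hww : star (((s⁻¹ : ℝ) : ℂ) • v) ⬝ᵥ (((s⁻¹ : ℝ) : ℂ) • v) = ((s⁻¹ * s : ℝ) : ℂ) := by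
    rw [star_smul, smul_dotProduct, dotProduct_smul, hvv]
    simp only [RCLike.star_def, Complex.conj_ofReal, smul_eq_mul]
    norm_cast
    rcases eq_or_ne s 0 with h | h
    · simp [h]
    · field_simp
  have hw : IsContraction (replicateCol Unit (((s⁻¹ : ℝ) : ℂ) • v)) := by
    refine isContraction_replicateCol ?_
    rw [hww]
    exact_mod_cast inv_mul_le_one
  refine ⟨B *ᵥ (((s⁻¹ : ℝ) : ℂ) • v), ?_, ?_⟩
  · rw [rankOne_eq_replicateCol_mul, replicateCol_mulVec]
    exact hw.posSemidef_sub B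
  · rw [dotProduct_mul_conjTranspose_mulVec, dotProduct_rankOne_mulVec, dotProduct_mulVec]
    have : star u ᵥ* B = star v := by rw [hv, star_mulVec, conjTranspose_conjTranspose]
    rw [this, dotProduct_smul, hvv, smul_eq_mul, ← Complex.ofReal_mul, Complex.norm_real]
    norm_cast
    rcases eq_or_ne s 0 with h | h
    · simp [← hv, ← hs, h]
    · rw [← hv, ← hs]
      field_simp
      simp

lemma IsStrategyOperator.posSemidef : ∀ {n : ℕ} {X : Fin n → Type uX} {Y : Fin n → Type uY}
    [∀ i, DecidableEq (X i)] [∀ i, Fintype (X i)] [∀ i, Fintype (Y i)]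
    {A : Matrix (Idx X Y) (Idx X Y) ℂ}, IsStrategyOperator n X Y A → A.PosSemidef
  | 0, _, _, _, _, _, _, h => by
    rw [h]
    exact (Matrix.PosSemidef.one (n := Unit) (R := ℂ)).submatrix fun _ => ()
  | _ + 1, _, _, _, _, _, _, h => h.1

variable {n : ℕ} (X : Fin n → Type uX) (Y : Fin n → Type uY)

/-- The bijection of classical states behind `reversal`. -/
def reversalEquiv : Idx X Y ≃ Idx (fun i : Fin n => Y i.rev) (fun i : Fin n => X i.rev) :=
  (Equiv.prodComm _ _).trans
    ((Equiv.piCongrLeft' X Fin.revPerm).prodCongr (Equiv.piCongrLeft' Y Fin.revPerm))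

lemma reversalEquiv_apply (p : Idx X Y) :
    reversalEquiv X Y p = (fun i : Fin n => p.2 i.rev, fun i : Fin n => p.1 i.rev) := rfl

/-- Transposing the steps of a circuit and reading them backwards turns the vector `D w` into its
reversal. -/
lemma circuitAmplitude_rev_mulVec {Z : Type*} [Fintype Z] [DecidableEq Z] (c w : Z → ℂ)
    (W : ∀ k, Y k → X k → Matrix Z Z ℂ) :
    (circuitAmplitude c W *ᵥ w) ∘ (reversalEquiv X Y).symm =
      circuitAmplitude (X := fun i : Fin n => Y i.rev) (Y := fun i : Fin n => X i.rev) w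
        (fun k x y => (W k.rev y x)ᵀ) *ᵥ c := by
  ext p
  obtain ⟨q, rfl⟩ := (reversalEquiv X Y).surjective p
  simp only [Function.comp_apply, Equiv.symm_apply_apply]
  exact (circuitAmplitude_rev c w W q).symm

/-- If an operator dominates `D' D'*` for the reversal of a circuit started at `w`, then it
dominates, up to the factor `r`, the reversal of the vector `√r D w` of the original circuit. -/
lemma posSemidef_reversed_of_circuit [∀ i, Fintype (X i)] [∀ i, Fintype (Y i)]
    {Z : Type*} [Fintype Z] [DecidableEq Z] (c w : Z → ℂ) (W : ∀ k, Y k → X k → Matrix Z Z ℂ)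
    (hc : IsContraction (replicateCol Unit c)) {r : ℝ≥0}
    {B : Matrix (Idx (fun i : Fin n => Y i.rev) fun i : Fin n => X i.rev)
      (Idx (fun i : Fin n => Y i.rev) fun i : Fin n => X i.rev) ℂ}
    (hB : (B - circuitAmplitude w (fun k x y => (W k.rev y x)ᵀ) *
      (circuitAmplitude w (fun k x y => (W k.rev y x)ᵀ))ᴴ).PosSemidef) :
    (((r : ℝ) : ℂ) • B - rankOne ((((√(r : ℝ) : ℝ) : ℂ) • (circuitAmplitude c W *ᵥ w)) ∘
      (reversalEquiv X Y).symm)).PosSemidef := by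
  have h1 := (posSemidef_smul_sub_rankOne_iff r (circuitAmplitude (X := fun i : Fin n => Y i.rev)
    (Y := fun i : Fin n => X i.rev) w (fun k x y => (W k.rev y x)ᵀ)) _).mpr ⟨c, hc, rfl⟩
  rw [← circuitAmplitude_rev_mulVec] at h1
  have h2 := (hB.smul (show (0 : ℂ) ≤ ((r : ℝ) : ℂ) by simp)).add h1
  rwa [smul_sub, sub_add_sub_cancel] at h2

theorem exists_isOptimumValue [∀ i, Fintype (X i)] [∀ i, DecidableEq (X i)]
    [∀ i, Fintype (Y i)] [∀ i, Nonempty (Y i)] (u : Idx X Y → ℂ) :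
    ∃ r, IsOptimumValue X Y (rankOne u) r := by
  have hne : {A | IsStrategyOperator n X Y A}.Nonempty := by
    have h1 : IsContraction (replicateCol Unit (0 : Unit → ℂ)) :=
      isContraction_replicateCol (by simp)
    have h2 (k : Fin n) : IsStrategyStep fun (_ : Y k) (_ : X k) => (0 : Matrix Unit Unit ℂ) := by
      have h0 : (Matrix.of fun (_ : Unit × X k) (_ : Unit × Y k) => (0 : ℂ)) = 0 := rfl
      simpa [IsStrategyStep, IsContraction, h0] using Matrix.PosSemidef.one
    obtain ⟨A, hA, -⟩ := exists_isStrategyOperator_of_circuit n X Y 0 _ h1 h2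
    exact ⟨A, hA⟩
  obtain ⟨A, hA, hmax⟩ := (isCompact_setOf_isStrategyOperator n X Y).exists_isMaxOn hne
    (f := fun A => (hsInner (rankOne u) A).re) (by unfold hsInner; fun_prop)
  exact ⟨_, ⟨A, hA, rfl⟩, by rintro _ ⟨B, hB, rfl⟩; exact hmax hB⟩

variable [∀ i, Fintype (X i)] [∀ i, DecidableEq (X i)]
  [∀ i, Fintype (Y i)] [∀ i, DecidableEq (Y i)]

lemma reversal_mul_rankOne_mul (u : Idx X Y → ℂ) :
    reversal X Y * rankOne u * (reversal X Y)ᴴ = rankOne (u ∘ (reversalEquiv X Y).symm) := by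
  have h : reversal X Y *ᵥ u = u ∘ (reversalEquiv X Y).symm := by
    ext p
    obtain ⟨q, rfl⟩ := (reversalEquiv X Y).surjective p
    simp only [reversal, mulVec, dotProduct, of_apply, ← reversalEquiv_apply,
      EmbeddingLike.apply_eq_iff_eq]
    simp
  rw [← h, rankOne, rankOne, mul_vecMulVec, vecMulVec_mul, star_mulVec]

/-- Composing the families of registers with a map that is equal to the identity changes nothing.
It is used for `f i = i.rev.rev`, for which `X (f i)` is not `X i` by definition. -/
lemma isOptimumValue_and_networkMinEntropy_comp_of_eq_id {f : Fin n → Fin n} (hf : f = id)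
    {u' : Idx (fun i => X (f i)) (fun i => Y (f i)) → ℂ} {u : Idx X Y → ℂ}
    (h : ∀ p : Idx X Y, u' (fun i => p.1 (f i), fun i => p.2 (f i)) = u p) :
    (∀ r, IsOptimumValue X Y (rankOne u) r →
      IsOptimumValue (fun i => X (f i)) (fun i => Y (f i)) (rankOne u') r) ∧
      networkMinEntropy (fun i => X (f i)) (fun i => Y (f i)) (rankOne u') =
        networkMinEntropy X Y (rankOne u) := by
  subst hf
  obtain rfl : u' = u := funext h
  exact ⟨fun r hr => hr, rfl⟩

variable [∀ i, Nonempty (X i)] [∀ i, Nonempty (Y i)]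

/-- A rank-one operator below a multiple of a strategy operator has its reversal below the same
multiple of a reversed strategy operator. -/
theorem IsStrategyOperator.exists_reversed {A : Matrix (Idx X Y) (Idx X Y) ℂ}
    (hA : IsStrategyOperator n X Y A) {r : ℝ≥0} {b : Idx X Y → ℂ}
    (h : (((r : ℝ) : ℂ) • A - rankOne b).PosSemidef) :
    ∃ B, IsStrategyOperator n (fun i : Fin n => Y i.rev) (fun i : Fin n => X i.rev) B ∧
      (((r : ℝ) : ℂ) • B - rankOne (b ∘ (reversalEquiv X Y).symm)).PosSemidef := by
  obtain ⟨c, W, hc, hW, rfl⟩ := hA.exists_circuit n X Y A (Function.Embedding.refl (Idx X Y))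
  obtain ⟨w, hw, rfl⟩ := (posSemidef_smul_sub_rankOne_iff _ _ _).mp h
  obtain ⟨B, hB, hBD⟩ := exists_isStrategyOperator_of_circuit n (fun i : Fin n => Y i.rev)
    (fun i : Fin n => X i.rev) w (fun k x y => (W k.rev y x)ᵀ) hw fun k => (hW k.rev).transpose
  exact ⟨B, hB, posSemidef_reversed_of_circuit X Y c w W hc hBD⟩

/-- The analogue of `IsStrategyOperator.exists_reversed` for conditioning operators. -/
theorem IsConditioningOperator.exists_reversed {Q : Matrix (Idx X Y) (Idx X Y) ℂ}
    (hQ : IsConditioningOperator n X Y Q) {r : ℝ≥0} {b : Idx X Y → ℂ}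
    (h : (((r : ℝ) : ℂ) • Q - rankOne b).PosSemidef) :
    ∃ Q', IsConditioningOperator n (fun i : Fin n => Y i.rev) (fun i : Fin n => X i.rev) Q' ∧
      (((r : ℝ) : ℂ) • Q' - rankOne (b ∘ (reversalEquiv X Y).symm)).PosSemidef := by
  obtain ⟨c, W, hc, hW, rfl⟩ := hQ.exists_circuit n X Y Q (Function.Embedding.refl (Idx X Y))
  obtain ⟨w, hw, rfl⟩ := (posSemidef_smul_sub_rankOne_iff _ _ _).mp h
  obtain ⟨Q', hQ', hQD⟩ := exists_isConditioningOperator_of_circuit n (fun i : Fin n => Y i.rev)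
    (fun i : Fin n => X i.rev) w (fun k x y => (W k.rev y x)ᵀ) hw fun k => (hW k.rev).transpose
  exact ⟨Q', hQ', posSemidef_reversed_of_circuit X Y c w W hc hQD⟩

theorem IsStrategyOperator.exists_reversed_hsInner_le {A : Matrix (Idx X Y) (Idx X Y) ℂ}
    (hA : IsStrategyOperator n X Y A) (u : Idx X Y → ℂ) :
    ∃ B, IsStrategyOperator n (fun i : Fin n => Y i.rev) (fun i : Fin n => X i.rev) B ∧
      (hsInner (rankOne u) A).re ≤
        (hsInner (rankOne (u ∘ (reversalEquiv X Y).symm)) B).re := by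
  obtain ⟨b, hb, hub⟩ := exists_rankOne_le hA.posSemidef u
  obtain ⟨B, hB, hBb⟩ := hA.exists_reversed X Y (r := 1) (b := b) (by simpa using hb)
  refine ⟨B, hB, ?_⟩
  have h1 := hBb.re_dotProduct_nonneg (u ∘ (reversalEquiv X Y).symm)
  have h2 : star (u ∘ (reversalEquiv X Y).symm) ⬝ᵥ (b ∘ (reversalEquiv X Y).symm) =
      star u ⬝ᵥ b :=
    Fintype.sum_equiv (reversalEquiv X Y).symm _ _ fun _ => rfl
  rw [hsInner_rankOne, hsInner_rankOne, hub, dotProduct_rankOne_mulVec]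
  rw [sub_mulVec, dotProduct_sub, dotProduct_rankOne_mulVec, h2] at h1
  simpa using h1

/-- The reversed conditioning operator depends on the factor `r` in `u u* ≤ r Q`, so the infima over
`Q` and `r` are compared jointly. -/
theorem networkMinEntropy_le_reversed (u : Idx X Y → ℂ) :
    networkMinEntropy X Y (rankOne u) ≤ networkMinEntropy (fun i : Fin n => Y i.rev)
      (fun i : Fin n => X i.rev) (rankOne (u ∘ (reversalEquiv X Y).symm)) := by
  have hlog : 0 < ((Real.log 2 : ℝ) : EReal) := by exact_mod_cast Real.log_pos one_lt_two
  refine EReal.neg_le_neg_iff.mpr (le_iInf₂ fun Q hQ => ?_)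
  rw [maxRelEntropy, EReal.le_div_iff_mul_le hlog (EReal.coe_ne_top _),
    ← ENNReal.logOrderIso_apply, OrderIso.map_iInf]
  refine le_iInf fun r => ?_
  rw [OrderIso.map_iInf]
  refine le_iInf fun hr => ?_
  rw [ENNReal.logOrderIso_apply, ← EReal.le_div_iff_mul_le hlog (EReal.coe_ne_top _)]
  obtain ⟨Q', hQ', hr'⟩ := hQ.exists_reversed X Y hr
  refine (iInf₂_le Q' hQ').trans (EReal.div_le_div_right_of_nonneg hlog.le ?_)
  exact ENNReal.log_monotone (iInf₂_le r hr')

end Reversal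

end QuantumStrategy

theorem corollary2 (n : ℕ) (hn : 0 < n) (X : Fin n → Type uX) (Y : Fin n → Type uY)
    [∀ i, Fintype (X i)] [∀ i, DecidableEq (X i)] [∀ i, Nonempty (X i)]
    [∀ i, Fintype (Y i)] [∀ i, DecidableEq (Y i)] [∀ i, Nonempty (Y i)]
    (u : QuantumStrategy.Idx X Y → ℂ) :
    (∃ r : ℝ,
      QuantumStrategy.IsOptimumValue X Y (QuantumStrategy.rankOne u) r ∧
      QuantumStrategy.IsOptimumValue (fun i : Fin n => Y i.rev) (fun i : Fin n => X i.rev)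
        (QuantumStrategy.reversal X Y * QuantumStrategy.rankOne u *
          (QuantumStrategy.reversal X Y).conjTranspose) r) ∧
    QuantumStrategy.networkMinEntropy X Y (QuantumStrategy.rankOne u) =
      QuantumStrategy.networkMinEntropy (fun i : Fin n => Y i.rev) (fun i : Fin n => X i.rev)
        (QuantumStrategy.reversal X Y * QuantumStrategy.rankOne u *
          (QuantumStrategy.reversal X Y).conjTranspose) := by
  open QuantumStrategy in
  rw [reversal_mul_rankOne_mul]
  -- Reversal acts twice on `u`, which gives the two inequalities in each of the equalities.
  set u' := u ∘ (reversalEquiv X Y).symm with hu'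
  obtain ⟨hopt, hent⟩ := isOptimumValue_and_networkMinEntropy_comp_of_eq_id X Y
    (f := fun i : Fin n => i.rev.rev)
    (funext Fin.rev_rev) (u := u)
    (u' := u' ∘ (reversalEquiv (fun i : Fin n => Y i.rev) fun i : Fin n => X i.rev).symm)
    (fun p => by
      change (u' ∘ (reversalEquiv _ _).symm) (reversalEquiv _ _ (reversalEquiv X Y p)) = u p
      simp only [hu', Function.comp_apply, Equiv.symm_apply_apply])
  constructor
  · obtain ⟨r, hr⟩ := exists_isOptimumValue X Y u
    have hle : ∀ B, IsStrategyOperator n (fun i : Fin n => Y i.rev) (fun i : Fin n => X i.rev) B →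
        (hsInner (rankOne u') B).re ≤ r := fun B hB => by
      obtain ⟨C, hC, hBC⟩ := hB.exists_reversed_hsInner_le _ _ u'
      exact hBC.trans ((hopt r hr).2 ⟨C, hC, rfl⟩)
    refine ⟨r, hr, ?_, by rintro _ ⟨B, hB, rfl⟩; exact hle B hB⟩
    obtain ⟨A, hA, hAr⟩ := hr.1
    obtain ⟨B, hB, hAB⟩ := hA.exists_reversed_hsInner_le X Y u
    exact ⟨B, hB, le_antisymm (hAr.trans_le hAB) (hle B hB)⟩
  · exact le_antisymm (networkMinEntropy_le_reversed X Y u)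
      ((networkMinEntropy_le_reversed _ _ u').trans_eq hent)
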